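/- Let $\mu$ be a finite Borel measure on $\mathbb{C}$ whose support is bounded and infinite. Let $\{\varphi_n\}_{n\ge 0}$ be its orthonormal polynomials, obtained by Gram–Schmidt orthogonalization of $1,z,z^2,\dots$ in $L^2(\mu)$, with $\varphi_n$ of degree $n$ and leading coefficient $\kappa_n>0$, and let $$M_{j,k}=\int_{\mathbb{C}}\overline{\varphi_{j-1}(z)}\,z\,\varphi_{k-1}(z)\,d\mu(z),\qquad j,k\ge 1 .$$ Assume that there are $R>0$ and a function $f$, analytic in $\{z:R<|z|\le\infty\}$, such that $$\lim_{n\to\infty}\frac{\varphi_n(z)}{\varphi_{n+1}(z)}=f(z),\qquad R<|z|\le\infty,$$ and that $\liminf_{n\to\infty}\kappa_n/\kappa_{n+1}>0$. Then near infinity $1/f$ has an inverse function with a Laurent expansion of the form below: there is a function $g$ satisfying, for all $z$ of sufficiently large modulus, $$\frac{1}{f(g(z))}=z=g\left(\frac{1}{f(z)}\right),\qquad g(z)=\beta_{-1}z+\beta_0+\frac{\beta_1}{z}+\frac{\beta_2}{z^2}+\cdots .$$ Moreover, for any such $g$, with Laurent coefficients $\beta_{-1},\beta_0,\beta_1,\dots$,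 $$\lim_{n\to\infty}M_{n-j,n}=\beta_j\qquad\text{for every integer } j\ge -1 .$$ -/

import Mathlib

open MeasureTheory Filter Topology Polynomial
open scoped ComplexConjugate

noncomputable section

/-- The sesquilinear form of `L²(μ)` on polynomials, `∫ conj (p z) * q z dμ(z)`. -/
def polyInner (μ : Measure ℂ) (p q : ℂ[X]) : ℂ :=
  ∫ z, conj (p.eval z) * q.eval z ∂μ

/-- The monic orthogonal polynomials `Φ_n` of `μ`: Gram-Schmidt orthogonalization of
`1, z, z², …` in `L²(μ)`. -/
def monicOrthoPoly (μ : Measure ℂ) : ℕ → ℂ[X]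
  | n => X ^ n - ∑ k : Fin n,
      C (polyInner μ (monicOrthoPoly μ k) (X ^ n) /
        polyInner μ (monicOrthoPoly μ k) (monicOrthoPoly μ k)) * monicOrthoPoly μ k
termination_by n => n
decreasing_by all_goals exact k.2

/-- The orthonormal polynomials `φ_n = Φ_n / ‖Φ_n‖_{L²(μ)}`. -/
def orthoPoly (μ : Measure ℂ) (n : ℕ) : ℂ[X] :=
  C (((√(∫ z, ‖(monicOrthoPoly μ n).eval z‖ ^ 2 ∂μ))⁻¹ : ℝ) : ℂ) * monicOrthoPoly μ n

/-- The leading coefficient `κ_n` of `φ_n`; it is a positive real number when the support of `μ`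
is infinite and bounded. -/
def orthoLeadingCoeff (μ : Measure ℂ) (n : ℕ) : ℝ :=
  (orthoPoly μ n).leadingCoeff.re

/-- The matrix of the Bergman shift operator (multiplication by `z`) in the basis of orthonormal
polynomials, `M_{j,k} = ⟨z φ_{k-1}, φ_{j-1}⟩ = ∫ conj (φ_{j-1}) z φ_{k-1} dμ`. Rows and columns
are numbered from `1`; the values at `j = 0` or `k = 0` have no meaning. -/
def bergmanShiftMatrix (μ : Measure ℂ) : Matrix ℕ ℕ ℂ := fun j k =>
  ∫ z, conj ((orthoPoly μ (j - 1)).eval z) * (z * (orthoPoly μ (k - 1)).eval z) ∂μ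

/-- `f` is analytic in `{z : R < |z| ≤ ∞}`; at infinity this means that `w ↦ f (1 / w)` extends
analytically across `w = 0`. -/
structure IsAnalyticOutside (R : ℝ) (f : ℂ → ℂ) : Prop where
  analyticOnNhd : AnalyticOnNhd ℂ f {z | R < ‖z‖}
  analytic_at_infinity : ∃ F : ℂ → ℂ, AnalyticAt ℂ F 0 ∧ ∀ᶠ w in 𝓝[≠] (0 : ℂ), F w = f w⁻¹

/-- The orthonormal polynomials have ratio asymptotics `φ_n(z) / φ_{n+1}(z) → f(z)` on
`{z : R < |z|}`, with `f` analytic in `{z : R < |z| ≤ ∞}`. (At `z = ∞` every ratio vanishes, and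
so does `f`.) -/
structure HasRatioAsymptotics (μ : Measure ℂ) (R : ℝ) (f : ℂ → ℂ) : Prop where
  analytic : IsAnalyticOutside R f
  tendsto : ∀ z : ℂ, R < ‖z‖ →
    Tendsto (fun n : ℕ => (orthoPoly μ n).eval z / (orthoPoly μ (n + 1)).eval z) atTop (𝓝 (f z))

/-- `g` is the inverse function of `1 / f` near infinity:
`1 / f (g z) = z = g (1 / f z)` for all `z` of large modulus. -/
def IsInverseNearInfinity (f g : ℂ → ℂ) : Prop :=
  ∃ ρ : ℝ, 0 < ρ ∧ ∀ z : ℂ, ρ < ‖z‖ → 1 / f (g z) = z ∧ g (1 / f z) = z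

/-- `g z = β₋₁ z + β₀ + β₁ / z + β₂ / z² + ⋯` for all `z` of large modulus. The term with index
`k : ℕ` is `β_{k-1} z^{1-k}`. -/
def HasLaurentExpansionAtInfinity (g : ℂ → ℂ) (β : ℤ → ℂ) : Prop :=
  ∃ ρ : ℝ, 0 < ρ ∧ ∀ z : ℂ, ρ < ‖z‖ →
    HasSum (fun k : ℕ => β ((k : ℤ) - 1) * z ^ (1 - (k : ℤ))) (g z)

end

/-! Expand `z φ_n = ∑ a_{n,k} φ_{n+1-k}`; the `a_{n,k}` (`shiftCoeff`) are the entries of column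
`n+1` of `M`, and all are bounded by `ρ`, a bound for the support. Divide by `φ_{n+1}(z)`. For large
`|z|` the recurrence itself forces `|φ_{n+1-k}(z)/φ_{n+1}(z)| ≤ 2^{-k}`
(`ne_zero_and_norm_le_of_recurrence`), and each such quotient tends to `f(z)^k`. Dominated
convergence then gives `∑ a_{n,k} f(z)^k → z f(z)` (`tendsto_tsum_of_recurrence`).

The identity `g(1/f(z)) = z` says `∑ β_{k-1} f(z)^k = z f(z)`. So the power series with coefficients
`a_{n,k} - β_{k-1}` tend to zero at the points `f(z)`, which accumulate at the origin, and
`tendsto_coeff_zero_of_tendsto_tsum` yields `a_{n,k} → β_{k-1}`.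

For the existence of `g`, the same recurrence gives `f → 0` at infinity, and the assumption on
`κ_n/κ_{n+1} = a_{n,0}` keeps `|z f(z)|` away from zero. Hence `w ↦ f(1/w)` has a simple zero at the
origin and the inverse function theorem applies. -/

/-! ### The sesquilinear form on polynomials. -/

section PolynomialInnerProduct

variable {μ : Measure ℂ} {ρ : ℝ}

theorem integrable_of_continuous_of_ae_norm_le {E : Type*} [NormedAddCommGroup E]
    [IsFiniteMeasure μ] (hρ : ∀ᵐ z ∂μ, ‖z‖ ≤ ρ) {u : ℂ → E} (hu : Continuous u) : Integrable u μ := by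
  obtain ⟨c, hc⟩ := (isCompact_closedBall (0 : ℂ) ρ).exists_bound_of_continuousOn hu.continuousOn
  refine Integrable.of_bound hu.aestronglyMeasurable c ?_
  filter_upwards [hρ] with z hz
  exact hc z (by simpa using hz)

theorem integrable_polyInner [IsFiniteMeasure μ] (hρ : ∀ᵐ z ∂μ, ‖z‖ ≤ ρ) (p q : ℂ[X]) :
    Integrable (fun z => conj (p.eval z) * q.eval z) μ :=
  integrable_of_continuous_of_ae_norm_le hρ
    ((Complex.continuous_conj.comp p.continuous).mul q.continuous)

theorem integrable_norm_eval_sq [IsFiniteMeasure μ] (hρ : ∀ᵐ z ∂μ, ‖z‖ ≤ ρ) (p : ℂ[X]) :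
    Integrable (fun z => ‖p.eval z‖ ^ 2) μ :=
  integrable_of_continuous_of_ae_norm_le hρ (p.continuous.norm.pow 2)

theorem polyInner_conj_symm (p q : ℂ[X]) : conj (polyInner μ p q) = polyInner μ q p := by
  unfold polyInner
  rw [← integral_conj]
  simp [mul_comm]

theorem polyInner_C_mul_right (c : ℂ) (p q : ℂ[X]) :
    polyInner μ p (C c * q) = c * polyInner μ p q := by
  unfold polyInner
  rw [← integral_const_mul]
  simp [mul_left_comm]

theorem polyInner_C_mul_left (c : ℂ) (p q : ℂ[X]) :
    polyInner μ (C c * p) q = conj c * polyInner μ p q := by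
  rw [← polyInner_conj_symm, polyInner_C_mul_right, map_mul, polyInner_conj_symm]

theorem polyInner_sub_right [IsFiniteMeasure μ] (hρ : ∀ᵐ z ∂μ, ‖z‖ ≤ ρ) (p q s : ℂ[X]) :
    polyInner μ p (q - s) = polyInner μ p q - polyInner μ p s := by
  unfold polyInner
  rw [← integral_sub (integrable_polyInner hρ p q) (integrable_polyInner hρ p s)]
  simp [mul_sub]

theorem polyInner_sum_right {ι : Type*} [IsFiniteMeasure μ] (hρ : ∀ᵐ z ∂μ, ‖z‖ ≤ ρ) (p : ℂ[X]) (t : Finset ι)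
    (q : ι → ℂ[X]) : polyInner μ p (∑ i ∈ t, q i) = ∑ i ∈ t, polyInner μ p (q i) := by
  unfold polyInner
  rw [← integral_finsetSum _ fun i _ => integrable_polyInner hρ p (q i)]
  simp [eval_finsetSum, Finset.mul_sum]

theorem polyInner_self (p : ℂ[X]) :
    polyInner μ p p = ((∫ z, ‖p.eval z‖ ^ 2 ∂μ : ℝ) : ℂ) := by
  unfold polyInner
  rw [← integral_complex_ofReal]
  simp [Complex.conj_mul']

/-- If the integral vanished, `μ` would live on the finite, hence closed, root set of `p`, which
would then contain the support. -/
theorem integral_norm_eval_sq_pos [IsFiniteMeasure μ] (hρ : ∀ᵐ z ∂μ, ‖z‖ ≤ ρ) (hinf : μ.support.Infinite)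
    {p : ℂ[X]} (hp : p ≠ 0) : 0 < ∫ z, ‖p.eval z‖ ^ 2 ∂μ := by
  refine lt_of_le_of_ne (integral_nonneg fun z => by positivity) fun h => hinf ?_
  rw [eq_comm, integral_eq_zero_iff_of_nonneg (fun z => by positivity)
    (integrable_norm_eval_sq hρ p)] at h
  refine (p.roots.toFinset.finite_toSet).subset (Measure.support_subset_of_isClosed
    (Finset.finite_toSet _).isClosed ?_)
  filter_upwards [h] with z hz
  simpa [hp] using hz

end PolynomialInnerProduct

/-! ### Orthonormal polynomials and the expansion of `z φ_n`. -/

section OrthonormalPolynomials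

variable {μ : Measure ℂ} {ρ : ℝ}

theorem monicOrthoPoly_monic_natDegree (n : ℕ) :
    (monicOrthoPoly μ n).Monic ∧ (monicOrthoPoly μ n).natDegree = n := by
  induction n using Nat.strong_induction_on with
  | _ n ih =>
    have hdeg : (∑ k : Fin n, C (polyInner μ (monicOrthoPoly μ k) (X ^ n) /
        polyInner μ (monicOrthoPoly μ k) (monicOrthoPoly μ k)) * monicOrthoPoly μ k).degree
        < (n : WithBot ℕ) := by
      rw [← mem_degreeLT]
      refine Submodule.sum_mem _ fun k _ => ?_
      rw [mem_degreeLT, ← smul_eq_C_mul]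
      refine (degree_smul_le _ _).trans_lt ?_
      rw [degree_eq_natDegree (ih k k.2).1.ne_zero, (ih k k.2).2]
      exact_mod_cast k.2
    rw [monicOrthoPoly]
    refine ⟨monic_X_pow_sub hdeg, natDegree_eq_of_degree_eq_some ?_⟩
    rw [degree_sub_eq_left_of_degree_lt (by rwa [degree_X_pow]), degree_X_pow]

theorem polyInner_monicOrthoPoly_of_lt [IsFiniteMeasure μ] (hρ : ∀ᵐ z ∂μ, ‖z‖ ≤ ρ) (hinf : μ.support.Infinite)
    (n : ℕ) : ∀ k < n, polyInner μ (monicOrthoPoly μ k) (monicOrthoPoly μ n) = 0 := by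
  induction n using Nat.strong_induction_on with
  | _ n ih =>
    intro k hk
    rw [monicOrthoPoly.eq_1 μ n, polyInner_sub_right hρ, polyInner_sum_right hρ, sub_eq_zero,
      Finset.sum_eq_single (⟨k, hk⟩ : Fin n)]
    · rw [polyInner_C_mul_right, div_mul_cancel₀]
      rw [polyInner_self]
      exact_mod_cast (integral_norm_eval_sq_pos hρ hinf
        (monicOrthoPoly_monic_natDegree k).1.ne_zero).ne'
    · intro i _ hi
      rw [polyInner_C_mul_right]
      rcases lt_or_gt_of_ne (fun h => hi (Fin.ext h) : (i : ℕ) ≠ k) with h | h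
      · rw [← polyInner_conj_symm (monicOrthoPoly μ i) (monicOrthoPoly μ k), ih k hk i h, map_zero,
          mul_zero]
      · rw [ih i i.2 k h, mul_zero]
    · simp

theorem norm_monicOrthoPoly_pos [IsFiniteMeasure μ] (hρ : ∀ᵐ z ∂μ, ‖z‖ ≤ ρ) (hinf : μ.support.Infinite) (n : ℕ) :
    0 < √(∫ z, ‖(monicOrthoPoly μ n).eval z‖ ^ 2 ∂μ) :=
  Real.sqrt_pos.2 (integral_norm_eval_sq_pos hρ hinf (monicOrthoPoly_monic_natDegree n).1.ne_zero)

theorem polyInner_orthoPoly [IsFiniteMeasure μ] (hρ : ∀ᵐ z ∂μ, ‖z‖ ≤ ρ) (hinf : μ.support.Infinite) (k n : ℕ) :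
    polyInner μ (orthoPoly μ k) (orthoPoly μ n) = if k = n then 1 else 0 := by
  unfold orthoPoly
  rw [polyInner_C_mul_right, polyInner_C_mul_left]
  split_ifs with h
  · subst h
    have h1 := norm_monicOrthoPoly_pos hρ hinf k
    have h2 := Real.sq_sqrt (integral_norm_eval_sq_pos hρ hinf
      (monicOrthoPoly_monic_natDegree (μ := μ) k).1.ne_zero).le
    rw [polyInner_self, Complex.conj_ofReal]
    norm_cast
    field_simp
    exact h2.symm
  · rcases lt_or_gt_of_ne h with h | h
    · rw [polyInner_monicOrthoPoly_of_lt hρ hinf n k h]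
      simp
    · rw [← polyInner_conj_symm (monicOrthoPoly μ n), polyInner_monicOrthoPoly_of_lt hρ hinf k n h]
      simp

theorem orthoPoly_leadingCoeff (n : ℕ) : (orthoPoly μ n).leadingCoeff =
    (((√(∫ z, ‖(monicOrthoPoly μ n).eval z‖ ^ 2 ∂μ))⁻¹ : ℝ) : ℂ) := by
  rw [orthoPoly, leadingCoeff_mul, (monicOrthoPoly_monic_natDegree n).1, leadingCoeff_C, mul_one]

theorem orthoPoly_leadingCoeff_eq_ofReal (n : ℕ) :
    (orthoPoly μ n).leadingCoeff = (orthoLeadingCoeff μ n : ℂ) := by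
  rw [orthoLeadingCoeff, orthoPoly_leadingCoeff, Complex.ofReal_re]

theorem orthoLeadingCoeff_pos [IsFiniteMeasure μ] (hρ : ∀ᵐ z ∂μ, ‖z‖ ≤ ρ) (hinf : μ.support.Infinite) (n : ℕ) :
    0 < orthoLeadingCoeff μ n := by
  rw [orthoLeadingCoeff, orthoPoly_leadingCoeff, Complex.ofReal_re]
  exact inv_pos.2 (norm_monicOrthoPoly_pos hρ hinf n)

theorem natDegree_orthoPoly [IsFiniteMeasure μ] (hρ : ∀ᵐ z ∂μ, ‖z‖ ≤ ρ) (hinf : μ.support.Infinite) (n : ℕ) :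
    (orthoPoly μ n).natDegree = n := by
  rw [orthoPoly, natDegree_C_mul, (monicOrthoPoly_monic_natDegree n).2]
  exact_mod_cast (inv_pos.2 (norm_monicOrthoPoly_pos hρ hinf n)).ne'

theorem orthoPoly_ne_zero [IsFiniteMeasure μ] (hρ : ∀ᵐ z ∂μ, ‖z‖ ≤ ρ) (hinf : μ.support.Infinite) (n : ℕ) :
    orthoPoly μ n ≠ 0 := by
  intro h
  have := polyInner_orthoPoly hρ hinf n n
  simp [h, polyInner] at this

/-- Polynomials of degree less than `n` are combinations of the first `n` orthonormal
polynomials. -/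
theorem exists_eq_sum_orthoPoly [IsFiniteMeasure μ] (hρ : ∀ᵐ z ∂μ, ‖z‖ ≤ ρ) (hinf : μ.support.Infinite) (n : ℕ) :
    ∀ p : ℂ[X], p.degree < n → ∃ c : ℕ → ℂ, p = ∑ k ∈ Finset.range n, C (c k) * orthoPoly μ k := by
  induction n with
  | zero =>
    intro p hp
    exact ⟨0, by simpa [Nat.WithBot.lt_zero_iff] using hp⟩
  | succ n ih =>
    intro p hp
    have hκ := (orthoLeadingCoeff_pos (μ := μ) hρ hinf n).ne'
    have hlc : (orthoPoly μ n).coeff n = (orthoLeadingCoeff μ n : ℂ) := by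
      rw [← orthoPoly_leadingCoeff_eq_ofReal, leadingCoeff, natDegree_orthoPoly hρ hinf]
    set a : ℂ := p.coeff n / orthoLeadingCoeff μ n with ha
    obtain ⟨c, hc⟩ := ih (p - C a * orthoPoly μ n) (by
      rw [degree_lt_iff_coeff_zero] at hp ⊢
      intro m hm
      rw [coeff_sub, coeff_C_mul]
      rcases hm.eq_or_lt with rfl | h
      · rw [hlc, ha, div_mul_cancel₀ _ (by exact_mod_cast hκ), sub_self]
      · rw [hp m h, coeff_eq_zero_of_natDegree_lt (by rwa [natDegree_orthoPoly hρ hinf])]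
        simp)
    refine ⟨fun k => if k = n then a else c k, ?_⟩
    simp only [Finset.sum_range_succ, if_true]
    rw [Finset.sum_congr rfl
      (g := fun k => C (c k) * orthoPoly μ k), ← hc, sub_add_cancel]
    intro k hk
    rw [if_neg (Finset.mem_range.1 hk).ne]

theorem eq_sum_polyInner_mul_orthoPoly [IsFiniteMeasure μ] (hρ : ∀ᵐ z ∂μ, ‖z‖ ≤ ρ) (hinf : μ.support.Infinite)
    {n : ℕ} {p : ℂ[X]} (hp : p.degree < n) :
    p = ∑ k ∈ Finset.range n, C (polyInner μ (orthoPoly μ k) p) * orthoPoly μ k := by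
  obtain ⟨c, hc⟩ := exists_eq_sum_orthoPoly hρ hinf n p hp
  have h : ∀ k ∈ Finset.range n, polyInner μ (orthoPoly μ k) p = c k := by
    intro k hk
    rw [hc, polyInner_sum_right hρ, Finset.sum_eq_single k]
    · rw [polyInner_C_mul_right, polyInner_orthoPoly hρ hinf, if_pos rfl, mul_one]
    · intro i _ hi
      rw [polyInner_C_mul_right, polyInner_orthoPoly hρ hinf, if_neg hi.symm, mul_zero]
    · exact fun h => absurd hk h
  conv_lhs => rw [hc]
  exact Finset.sum_congr rfl fun k hk => by rw [h k hk]

theorem X_mul_orthoPoly_eq_sum [IsFiniteMeasure μ] (hρ : ∀ᵐ z ∂μ, ‖z‖ ≤ ρ) (hinf : μ.support.Infinite) (n : ℕ) :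
    X * orthoPoly μ n = ∑ k ∈ Finset.range (n + 2),
      C (polyInner μ (orthoPoly μ k) (X * orthoPoly μ n)) * orthoPoly μ k := by
  refine eq_sum_polyInner_mul_orthoPoly hρ hinf ?_
  rw [degree_mul, degree_X, degree_eq_natDegree (orthoPoly_ne_zero hρ hinf n),
    natDegree_orthoPoly hρ hinf]
  norm_cast
  omega

/-- Compare coefficients of degree `n + 1` in the expansion of `z φ_n`: only `φ_{n+1}` contributes.
This is where the ratio of leading coefficients enters. -/
theorem polyInner_orthoPoly_succ [IsFiniteMeasure μ] (hρ : ∀ᵐ z ∂μ, ‖z‖ ≤ ρ) (hinf : μ.support.Infinite) (n : ℕ) :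
    polyInner μ (orthoPoly μ (n + 1)) (X * orthoPoly μ n) =
      ((orthoLeadingCoeff μ n / orthoLeadingCoeff μ (n + 1) : ℝ) : ℂ) := by
  have h := congrArg (fun p => p.coeff (n + 1)) (X_mul_orthoPoly_eq_sum (μ := μ) hρ hinf n)
  have hlc (m : ℕ) : (orthoPoly μ m).coeff m = (orthoLeadingCoeff μ m : ℂ) := by
    rw [← orthoPoly_leadingCoeff_eq_ofReal, leadingCoeff, natDegree_orthoPoly hρ hinf]
  simp only [coeff_X_mul, finsetSum_coeff, coeff_C_mul] at h
  rw [Finset.sum_range_succ, hlc, hlc, Finset.sum_eq_zero, zero_add] at h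
  · have := (orthoLeadingCoeff_pos (μ := μ) hρ hinf (n + 1)).ne'
    rw [Complex.ofReal_div, h, mul_div_cancel_right₀ _ (by exact_mod_cast this)]
  · intro k hk
    rw [coeff_eq_zero_of_natDegree_lt (by
      rw [natDegree_orthoPoly hρ hinf]; exact Finset.mem_range.1 hk), mul_zero]

/-- Pointwise `2ab ≤ a² + b²` replaces Cauchy–Schwarz, since both polynomials have norm one. -/
theorem norm_polyInner_orthoPoly_le [IsFiniteMeasure μ] (hρ : ∀ᵐ z ∂μ, ‖z‖ ≤ ρ) (hρ0 : 0 ≤ ρ)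
    (hinf : μ.support.Infinite) (k n : ℕ) :
    ‖polyInner μ (orthoPoly μ k) (X * orthoPoly μ n)‖ ≤ ρ := by
  have hnorm (m : ℕ) : ∫ z, ‖(orthoPoly μ m).eval z‖ ^ 2 ∂μ = 1 := by
    have := polyInner_orthoPoly (μ := μ) hρ hinf m m
    rw [polyInner_self, if_pos rfl] at this
    exact_mod_cast this
  have hi (m : ℕ) := integrable_norm_eval_sq hρ (orthoPoly μ m)
  have hint : Integrable (fun z => ρ / 2 * (‖(orthoPoly μ k).eval z‖ ^ 2 +
      ‖(orthoPoly μ n).eval z‖ ^ 2)) μ := ((hi k).add (hi n)).const_mul _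
  refine (norm_integral_le_of_norm_le hint ?_).trans_eq ?_
  · filter_upwards [hρ] with z hz
    rw [eval_mul, eval_X, norm_mul, norm_mul, RCLike.norm_conj]
    nlinarith [sq_nonneg (‖(orthoPoly μ k).eval z‖ - ‖(orthoPoly μ n).eval z‖),
      mul_nonneg (norm_nonneg ((orthoPoly μ k).eval z)) (norm_nonneg ((orthoPoly μ n).eval z))]
  · rw [integral_const_mul, integral_add (hi k) (hi n), hnorm, hnorm]
    ring

end OrthonormalPolynomials

/-! ### Power series with geometrically bounded coefficients. -/

section PowerSeries

theorem summable_mul_pow_of_norm_le {c : ℕ → ℂ} {B K : ℝ} (hc : ∀ k, ‖c k‖ ≤ B * K ^ k)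
    {u : ℂ} (hK : 0 ≤ K) (hu : K * ‖u‖ < 1) : Summable fun k => c k * u ^ k := by
  refine Summable.of_norm_bounded (g := fun k => B * (K * ‖u‖) ^ k)
    ((summable_geometric_of_lt_one (by positivity) hu).mul_left B) fun k => ?_
  rw [norm_mul, norm_pow, mul_pow, ← mul_assoc]
  exact mul_le_mul_of_nonneg_right (hc k) (by positivity)

theorem tsum_mul_pow_eq_zero_add {c : ℕ → ℂ} {B K : ℝ} (hc : ∀ k, ‖c k‖ ≤ B * K ^ k)
    {u : ℂ} (hK : 0 ≤ K) (hu : K * ‖u‖ < 1) :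
    ∑' k, c k * u ^ k = c 0 + u * ∑' k, c (k + 1) * u ^ k := by
  rw [(summable_mul_pow_of_norm_le hc hK hu).tsum_eq_zero_add, ← tsum_mul_left]
  simp only [pow_zero, mul_one, pow_succ]
  congr 2
  ext k
  ring

theorem norm_tsum_mul_pow_sub_le {c : ℕ → ℂ} {B K : ℝ} (hc : ∀ k, ‖c k‖ ≤ B * K ^ k)
    {u : ℂ} (hK : 0 ≤ K) (hu : K * ‖u‖ ≤ 1 / 2) :
    ‖∑' k, c k * u ^ k - c 0‖ ≤ 2 * (B * K) * ‖u‖ := by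
  rw [tsum_mul_pow_eq_zero_add hc hK (by linarith), add_sub_cancel_left, norm_mul, mul_comm]
  refine mul_le_mul_of_nonneg_right ?_ (norm_nonneg u)
  have hB : 0 ≤ B := by simpa using (norm_nonneg _).trans (hc 0)
  have hs : HasSum (fun k : ℕ => B * K * (1 / 2 : ℝ) ^ k) (B * K * 2) :=
    hasSum_geometric_two.mul_left _
  rw [mul_comm 2]
  refine tsum_of_norm_bounded hs fun k => ?_
  rw [norm_mul, norm_pow]
  calc ‖c (k + 1)‖ * ‖u‖ ^ k ≤ B * K ^ (k + 1) * ‖u‖ ^ k := by gcongr; exact hc _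
    _ = B * K * (K * ‖u‖) ^ k := by ring
    _ ≤ _ := by gcongr

/-- If power series with uniformly geometrically bounded coefficients tend to zero at points
accumulating at the origin, then each coefficient tends to zero. -/
theorem tendsto_coeff_zero_of_tendsto_tsum {K : ℝ} (hK : 0 < K) (k : ℕ) :
    ∀ {c : ℕ → ℕ → ℂ} {B : ℝ}, (∀ n k, ‖c n k‖ ≤ B * K ^ k) →
    (∃ᶠ u in 𝓝[≠] (0 : ℂ), Tendsto (fun n => ∑' k, c n k * u ^ k) atTop (𝓝 0)) →
    Tendsto (fun n => c n k) atTop (𝓝 0) := by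
  have hsmall {δ : ℝ} (hδ : 0 < δ) (D : ℝ) : ∀ᶠ u in 𝓝[≠] (0 : ℂ), u ≠ 0 ∧ D * ‖u‖ < δ := by
    refine eventually_mem_nhdsWithin.and (Eventually.filter_mono nhdsWithin_le_nhds ?_)
    have : Tendsto (fun u : ℂ => D * ‖u‖) (𝓝 0) (𝓝 (D * ‖(0 : ℂ)‖)) :=
      tendsto_const_nhds.mul tendsto_id.norm
    rw [norm_zero, mul_zero] at this
    exact this.eventually_lt_const hδ
  have hzero {c : ℕ → ℕ → ℂ} {B : ℝ} (hc : ∀ n k, ‖c n k‖ ≤ B * K ^ k)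
      (h : ∃ᶠ u in 𝓝[≠] (0 : ℂ), Tendsto (fun n => ∑' k, c n k * u ^ k) atTop (𝓝 0)) :
      Tendsto (fun n => c n 0) atTop (𝓝 0) := by
    rw [Metric.tendsto_atTop]
    intro ε hε
    obtain ⟨u, hu, ⟨-, h1⟩, -, h2⟩ := (h.and_eventually
      ((hsmall one_half_pos K).and (hsmall (half_pos hε) (2 * (B * K))))).exists
    obtain ⟨N, hN⟩ := Metric.tendsto_atTop.1 hu (ε / 2) (half_pos hε)
    refine ⟨N, fun n hn => ?_⟩
    have h3 := hN n hn
    have h4 := norm_tsum_mul_pow_sub_le (hc n) hK.le h1.le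
    rw [dist_zero_right] at h3 ⊢
    have h5 := norm_sub_norm_le (c n 0) (∑' k, c n k * u ^ k)
    rw [norm_sub_rev] at h5
    linarith
  induction k with
  | zero => exact hzero
  | succ k ih =>
    -- Removing the constant term, which tends to zero by `hzero`, and dividing by `u` shifts the
    -- coefficients by one. The bound becomes `B * K`, so `c` and `B` must vary in the induction.
    intro c B hc h
    refine ih (c := fun n k => c n (k + 1)) (B := B * K)
      (fun n k => (hc n (k + 1)).trans_eq (by ring)) ?_
    refine (h.and_eventually (hsmall one_pos K)).mono ?_
    rintro u ⟨hu, hu0, hu1⟩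
    have := (hu.sub (hzero hc h)).div_const u
    simp only [sub_zero, zero_div] at this
    refine this.congr fun n => ?_
    rw [tsum_mul_pow_eq_zero_add (hc n) hK.le hu1, add_sub_cancel_left,
      mul_div_cancel_left₀ _ hu0]

/-- The coefficients of a power series which converges at `u ≠ 0` are geometrically bounded. -/
theorem exists_norm_le_mul_pow_of_summable {b : ℕ → ℂ} {u : ℂ} (hu : u ≠ 0)
    (h : Summable fun k => b k * u ^ k) :
    ∃ B K : ℝ, 0 ≤ B ∧ 1 ≤ K ∧ ∀ k, ‖b k‖ ≤ B * K ^ k := by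
  obtain ⟨B, hB⟩ := h.tendsto_atTop_zero.norm.bddAbove_range
  have hB' (k : ℕ) : ‖b k * u ^ k‖ ≤ B := hB ⟨k, rfl⟩
  have hB0 : 0 ≤ B := (norm_nonneg _).trans (hB' 0)
  refine ⟨B, max 1 ‖u‖⁻¹, hB0, le_max_left _ _, fun k => ?_⟩
  have hpos : 0 < ‖u‖ ^ k := by positivity
  calc ‖b k‖ ≤ B * ‖u‖⁻¹ ^ k := by
        rw [inv_pow, ← div_eq_mul_inv, le_div_iff₀ hpos]
        simpa using hB' k
    _ ≤ _ := by gcongr; exact le_max_right _ _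

end PowerSeries

/-! ### Growth and limits for bounded Hessenberg recurrences. -/

section HessenbergRecurrence

variable {e : ℕ → ℂ} {A : ℕ → ℕ → ℂ} {ρ r : ℝ} {z u : ℂ}

/-- Solutions of a recurrence with bounded upper Hessenberg coefficients grow geometrically when
the spectral parameter is large. -/
theorem ne_zero_and_norm_le_of_recurrence (hA : ∀ n k, ‖A n k‖ ≤ ρ) (hρ : 0 < ρ)
    (he : ∀ n, z * e n = ∑ k ∈ Finset.range (n + 2), A n k * e (n + 1 - k)) (he0 : e 0 ≠ 0)
    (hr0 : 0 < r) (hr1 : r < 1) (hz : ρ / r + ρ / (1 - r) ≤ ‖z‖) (n : ℕ) :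
    e n ≠ 0 ∧ ∀ k ≤ n, ‖e (n - k)‖ ≤ r ^ k * ‖e n‖ := by
  induction n with
  | zero => exact ⟨he0, fun k hk => by simp [Nat.le_zero.1 hk]⟩
  | succ n ih =>
    obtain ⟨hn, ih⟩ := ih
    have hpos : 0 < ‖e n‖ := norm_pos_iff.2 hn
    have hr : 0 < 1 - r := sub_pos.2 hr1
    have htail : ‖∑ k ∈ Finset.range (n + 1), A n (k + 1) * e (n + 1 - (k + 1))‖ ≤
        ρ / (1 - r) * ‖e n‖ := by
      calc _ ≤ ∑ k ∈ Finset.range (n + 1), ρ * ‖e n‖ * r ^ k := by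
            refine norm_sum_le_of_le _ fun k hk => ?_
            rw [norm_mul, Nat.add_sub_add_right, mul_assoc, mul_comm ‖e n‖]
            exact mul_le_mul (hA _ _) (ih k (by simpa [Nat.lt_succ_iff] using hk))
              (norm_nonneg _) hρ.le
        _ = ρ * ‖e n‖ * ∑ k ∈ Finset.range (n + 1), r ^ k := by rw [Finset.mul_sum]
        _ ≤ ρ * ‖e n‖ * (1 - r)⁻¹ := by
            gcongr
            rw [← tsum_geometric_of_lt_one hr0.le hr1]
            exact (summable_geometric_of_lt_one hr0.le hr1).sum_le_tsum _
              fun _ _ => by positivity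
        _ = _ := by ring
    -- The threshold on `‖z‖` splits accordingly: `ρ / (1 - r)` absorbs the tail, and the remaining
    -- `ρ / r` is dominated by the leading term, of size at most `ρ * ‖e (n + 1)‖`.
    have hstep : ‖e n‖ ≤ r * ‖e (n + 1)‖ := by
      have h1 := congrArg norm (he n)
      rw [Finset.sum_range_succ', norm_mul] at h1
      have h2 := (norm_add_le _ _).trans (add_le_add htail
        (norm_mul_le_of_le (hA n 0) (le_refl ‖e (n + 1 - 0)‖)))
      rw [← h1, Nat.sub_zero] at h2
      have h3 := mul_le_mul_of_nonneg_right hz hpos.le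
      have h4 : ρ / r * ‖e n‖ ≤ ρ * ‖e (n + 1)‖ := by linarith
      rw [div_mul_eq_mul_div, div_le_iff₀ hr0, mul_assoc, mul_comm _ r] at h4
      exact le_of_mul_le_mul_left h4 hρ
    refine ⟨fun h => ?_, fun k hk => ?_⟩
    · rw [h, norm_zero, mul_zero] at hstep
      linarith
    · cases k with
      | zero => simp
      | succ k =>
        rw [Nat.add_sub_add_right]
        calc _ ≤ r ^ k * ‖e n‖ := ih k (by omega)
          _ ≤ r ^ k * (r * ‖e (n + 1)‖) := by gcongr
          _ = _ := by ring

theorem tendsto_div_shift (hne : ∀ n, e n ≠ 0)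
    (hlim : Tendsto (fun n => e n / e (n + 1)) atTop (𝓝 u)) (k : ℕ) :
    Tendsto (fun n => e (n + 1 - k) / e (n + 1)) atTop (𝓝 (u ^ k)) := by
  induction k with
  | zero => simp [hne]
  | succ k ih =>
    rw [pow_succ']
    refine ((hlim.comp (tendsto_sub_atTop_nat k)).mul ih).congr' ?_
    filter_upwards [eventually_ge_atTop k] with n hn
    rw [Function.comp_apply, Nat.add_sub_add_right, ← Nat.sub_add_comm hn,
      div_mul_div_cancel₀ (hne _)]

/-- Dividing the recurrence by `e (n + 1)` and letting `n → ∞` replaces the quotients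
`e (n + 1 - k) / e (n + 1)` by the powers of the limit of the consecutive ratios. -/
theorem tendsto_tsum_of_recurrence (hA : ∀ n k, ‖A n k‖ ≤ ρ) (hA0 : ∀ n k, n + 1 < k → A n k = 0)
    (hρ : 0 < ρ) (he : ∀ n, z * e n = ∑ k ∈ Finset.range (n + 2), A n k * e (n + 1 - k))
    (he0 : e 0 ≠ 0) (hz : 4 * ρ ≤ ‖z‖)
    (hlim : Tendsto (fun n => e n / e (n + 1)) atTop (𝓝 u)) :
    Tendsto (fun n => ∑' k, A n k * u ^ k) atTop (𝓝 (z * u)) := by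
  have hgrowth := ne_zero_and_norm_le_of_recurrence hA hρ he he0 one_half_pos one_half_lt_one
    (hz.trans' (le_of_eq (by norm_num; ring)))
  have hquot (n k : ℕ) (hk : k ≤ n + 1) : ‖e (n + 1 - k) / e (n + 1)‖ ≤ (1 / 2 : ℝ) ^ k := by
    rw [norm_div, div_le_iff₀ (norm_pos_iff.2 (hgrowth _).1)]
    exact (hgrowth (n + 1)).2 k hk
  have hu : ‖u‖ ≤ 1 / 2 := le_of_tendsto hlim.norm (Eventually.of_forall fun n => by
    simpa using hquot n 1 (by omega))
  have hdiff : Tendsto (fun n => ∑' k, A n k * (e (n + 1 - k) / e (n + 1) - u ^ k)) atTop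
      (𝓝 (∑' _ : ℕ, (0 : ℂ))) := by
    refine tendsto_tsum_of_dominated_convergence
      (bound := fun k => ρ * (2 * (1 / 2 : ℝ) ^ k))
      ((summable_geometric_two.mul_left 2).mul_left ρ) (fun k => ?_)
      (Eventually.of_forall fun n k => ?_)
    · have h := (tendsto_div_shift (fun n => (hgrowth n).1) hlim k).sub_const (u ^ k)
      rw [sub_self] at h
      refine squeeze_zero_norm (fun n => ?_) (by simpa using h.norm.const_mul ρ)
      rw [norm_mul]
      exact mul_le_mul_of_nonneg_right (hA n k) (norm_nonneg _)
    -- For `k > n + 1` truncated subtraction turns the quotient into `e 0 / e (n + 1)`; there the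
    -- vanishing of `A n k` is used instead.
    · rcases le_or_gt k (n + 1) with hk | hk
      · rw [norm_mul]
        refine mul_le_mul (hA n k) ((norm_sub_le _ _).trans ?_) (norm_nonneg _) hρ.le
        rw [two_mul, norm_pow]
        exact add_le_add (hquot n k hk) (by gcongr)
      · rw [hA0 n k hk, zero_mul, norm_zero]
        positivity
  rw [tsum_zero] at hdiff
  have hmain := (hlim.const_mul z).sub hdiff
  rw [sub_zero] at hmain
  refine hmain.congr fun n => ?_
  have hfin : HasSum (fun k => A n k * (e (n + 1 - k) / e (n + 1))) (z * (e n / e (n + 1))) := by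
    rw [mul_div_assoc', he n, Finset.sum_div]
    simp_rw [mul_div_assoc]
    refine hasSum_sum_of_ne_finset_zero fun k hk => ?_
    rw [hA0 n k (by simpa [Nat.succ_le_iff] using hk), zero_mul]
  have hsum : Summable fun k => A n k * u ^ k :=
    summable_mul_pow_of_norm_le (B := ρ) (K := 1) (by simpa using hA n) zero_le_one (by linarith)
  simp_rw [mul_sub]
  rw [hfin.summable.tsum_sub hsum, hfin.tsum_eq, sub_sub_cancel]

end HessenbergRecurrence

/-! ### Inversion near infinity. -/

section AnalyticInverse

open Bornology

theorem exists_radius_of_eventually_cobounded {P : ℂ → Prop} (h : ∀ᶠ z in cobounded ℂ, P z) :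
    ∃ ρ : ℝ, 0 < ρ ∧ ∀ z : ℂ, ρ < ‖z‖ → P z := by
  obtain ⟨ρ, -, hρ⟩ := hasBasis_cobounded_norm.eventually_iff.1 h
  exact ⟨max ρ 1, by positivity, fun z hz => hρ ((le_max_left _ _).trans hz.le)⟩

theorem eventually_cobounded_lt_norm (ρ : ℝ) : ∀ᶠ z in cobounded ℂ, ρ < ‖z‖ :=
  tendsto_norm_cobounded_atTop.eventually_gt_atTop ρ

/-- The difference quotients `F w / w` have norm at least `c`, and so does their limit. -/
theorem deriv_ne_zero_of_mul_norm_le {F : ℂ → ℂ} {c : ℝ} (hF : DifferentiableAt ℂ F 0)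
    (hF0 : F 0 = 0) (hc : 0 < c) (h : ∀ᶠ w in 𝓝[≠] (0 : ℂ), c * ‖w‖ ≤ ‖F w‖) :
    deriv F 0 ≠ 0 := by
  have hs := (hasDerivAt_iff_tendsto_slope.1 hF.hasDerivAt).norm
  refine norm_pos_iff.1 (hc.trans_le (ge_of_tendsto hs ?_))
  filter_upwards [h, eventually_mem_nhdsWithin] with w hw hw0
  rw [slope_def_field, hF0, sub_zero, sub_zero, norm_div, le_div_iff₀ (norm_pos_iff.2 hw0)]
  exact hw

/-- If `w ↦ f (1 / w)` extends to an analytic function `F` with a simple zero at the origin, then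
`1 / f` is invertible near infinity, and the inverse has a Laurent expansion with a simple pole. -/
theorem exists_inverse_near_infinity {f F : ℂ → ℂ} (hF : AnalyticAt ℂ F 0) (hF0 : F 0 = 0)
    (hF' : deriv F 0 ≠ 0) (hfF : ∀ᶠ w in 𝓝[≠] (0 : ℂ), F w = f w⁻¹) :
    ∃ (g : ℂ → ℂ) (β : ℤ → ℂ), IsInverseNearInfinity f g ∧ HasLaurentExpansionAtInfinity g β := by
  set G := hF.hasStrictDerivAt.localInverse _ _ _ hF' with hG
  have hGan : AnalyticAt ℂ G 0 := by simpa only [hF0] using hF.analyticAt_localInverse hF'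
  have hleft : ∀ᶠ w in 𝓝 (0 : ℂ), G (F w) = w :=
    hF.hasStrictDerivAt.eventually_left_inverse hF'
  have hright : ∀ᶠ w in 𝓝 (0 : ℂ), F (G w) = w := by
    simpa only [hF0] using hF.hasStrictDerivAt.eventually_right_inverse hF'
  have hG0 : G 0 = 0 := by simpa only [hF0] using hleft.self_of_nhds
  have hG' : deriv G 0 ≠ 0 := by
    have h := hF.hasStrictDerivAt.to_localInverse hF'
    rw [hF0] at h
    rw [h.hasDerivAt.deriv]
    exact inv_ne_zero hF'
  have hGne : ∀ᶠ w in 𝓝[≠] (0 : ℂ), G w ≠ 0 := by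
    filter_upwards [nhdsWithin_le_nhds hright, eventually_mem_nhdsWithin] with w hw hw0 h
    rw [h, hF0] at hw
    exact hw0 hw.symm
  have hGt : Tendsto G (𝓝[≠] 0) (𝓝[≠] 0) := by
    refine tendsto_nhdsWithin_iff.2 ⟨?_, hGne⟩
    have := hGan.continuousAt.tendsto
    rw [hG0] at this
    exact this.mono_left nhdsWithin_le_nhds
  -- `dslope G 0` is `G w / w`, with the value `G'(0) ≠ 0` filled in at the origin. Its reciprocal
  -- is therefore analytic, and `1 / G(1/z)` is `z` times that reciprocal at `1/z`.
  have hH : AnalyticAt ℂ (dslope G 0) 0 := by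
    obtain ⟨p, hp⟩ := hGan
    exact ⟨_, hp.has_fpower_series_dslope_fslope⟩
  obtain ⟨p, hp⟩ := hH.inv (by rwa [dslope_same])
  have hser := hasFPowerSeriesAt_iff.1 hp
  have hinv := tendsto_inv₀_cobounded' (α := ℂ)
  refine ⟨fun z => (G z⁻¹)⁻¹, fun j => p.coeff (j + 1).toNat,
    exists_radius_of_eventually_cobounded ?_, exists_radius_of_eventually_cobounded ?_⟩
  · filter_upwards [hinv.eventually (hGt.eventually hfF), hinv.eventually hfF,
      hinv.eventually (nhdsWithin_le_nhds hright), hinv.eventually (nhdsWithin_le_nhds hleft)]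
      with z h1 h2 h3 h4
    rw [inv_inv] at h2
    refine ⟨?_, ?_⟩
    · rw [← h1, h3, one_div, inv_inv]
    · rw [one_div, inv_inv, ← h2, h4, inv_inv]
  · filter_upwards [hinv.eventually (nhdsWithin_le_nhds hser), eventually_cobounded_lt_norm 0]
      with z hz hz0
    have hz0 : z ≠ 0 := norm_pos_iff.1 hz0
    have hval : (G z⁻¹)⁻¹ = z * (dslope G 0)⁻¹ (0 + z⁻¹) := by
      rw [zero_add, Pi.inv_apply, dslope_of_ne _ (inv_ne_zero hz0), slope_def_field, hG0]
      field_simp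
      simp
    rw [hval]
    refine (hz.mul_left z).congr_fun fun k => ?_
    rw [smul_eq_mul, show ((k : ℤ) - 1 + 1).toNat = k by simp, sub_eq_add_neg (1 : ℤ),
      zpow_add₀ hz0, zpow_one, zpow_neg, zpow_natCast, inv_pow]
    ring

/-- Multiplying the Laurent series at `1 / u` by `u` cancels the pole term and leaves a power series
in `u`. -/
theorem hasSum_laurent_of_inverse {g : ℂ → ℂ} {β : ℤ → ℂ} {u z : ℂ} (hu : u ≠ 0)
    (h : HasSum (fun k : ℕ => β ((k : ℤ) - 1) * (1 / u) ^ (1 - (k : ℤ))) (g (1 / u)))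
    (hg : g (1 / u) = z) : HasSum (fun k : ℕ => β ((k : ℤ) - 1) * u ^ k) (z * u) := by
  rw [hg] at h
  refine (h.mul_right u).congr_fun fun k => ?_
  rw [one_div, inv_zpow', mul_assoc, ← zpow_add_one₀ hu, neg_sub, sub_add_cancel, zpow_natCast]

end AnalyticInverse

/-! ### Asymptotics of the shift coefficients. -/

section Asymptotics

open Bornology

/-- The coefficient of `φ_{n+1-k}` in the expansion of `z φ_n`. -/
noncomputable def shiftCoeff (μ : Measure ℂ) (n k : ℕ) : ℂ :=
  if k ≤ n + 1 then polyInner μ (orthoPoly μ (n + 1 - k)) (X * orthoPoly μ n) else 0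

/-- Rows and columns start at `1`: column `n + 1` belongs to `φ_n`, row `n + 2 - k` to `φ_{n+1-k}`.
The bound on `k` keeps the row index positive. -/
theorem bergmanShiftMatrix_eq_shiftCoeff (μ : Measure ℂ) {n k : ℕ} (hk : k ≤ n + 1) :
    bergmanShiftMatrix μ (((n + 1 : ℕ) : ℤ) - ((k : ℤ) - 1)).toNat (n + 1) = shiftCoeff μ n k := by
  rw [shiftCoeff, if_pos hk, bergmanShiftMatrix, polyInner,
    show (((n + 1 : ℕ) : ℤ) - ((k : ℤ) - 1)).toNat - 1 = n + 1 - k by omega]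
  simp

variable {μ : Measure ℂ} [IsFiniteMeasure μ] {ρ : ℝ}

theorem norm_shiftCoeff_le (hρ : ∀ᵐ z ∂μ, ‖z‖ ≤ ρ) (hρ0 : 0 < ρ) (hinf : μ.support.Infinite)
    (n k : ℕ) : ‖shiftCoeff μ n k‖ ≤ ρ := by
  unfold shiftCoeff
  split_ifs
  · exact norm_polyInner_orthoPoly_le hρ hρ0.le hinf _ _
  · simpa using hρ0.le

theorem mul_eval_orthoPoly_eq_sum (hρ : ∀ᵐ z ∂μ, ‖z‖ ≤ ρ) (hinf : μ.support.Infinite) (z : ℂ)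
    (n : ℕ) : z * (orthoPoly μ n).eval z = ∑ k ∈ Finset.range (n + 2),
      shiftCoeff μ n k * (orthoPoly μ (n + 1 - k)).eval z := by
  have h := congrArg (eval z) (X_mul_orthoPoly_eq_sum (μ := μ) hρ hinf n)
  rw [eval_mul, eval_X, eval_finsetSum, ← Finset.sum_range_reflect] at h
  rw [h]
  refine Finset.sum_congr rfl fun k hk => ?_
  rw [Finset.mem_range] at hk
  rw [shiftCoeff, if_pos (by omega), eval_mul, eval_C,
    show n + 2 - 1 - k = n + 1 - k by omega]

theorem eval_orthoPoly_zero_ne_zero (hρ : ∀ᵐ z ∂μ, ‖z‖ ≤ ρ) (hinf : μ.support.Infinite) (z : ℂ) :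
    (orthoPoly μ 0).eval z ≠ 0 := by
  have h := orthoPoly_ne_zero (μ := μ) hρ hinf 0
  rw [eq_C_of_natDegree_eq_zero (natDegree_orthoPoly hρ hinf 0)] at h ⊢
  simpa using h

theorem tendsto_tsum_shiftCoeff (hρ : ∀ᵐ z ∂μ, ‖z‖ ≤ ρ) (hρ0 : 0 < ρ)
    (hinf : μ.support.Infinite) {z u : ℂ} (hz : 4 * ρ ≤ ‖z‖)
    (hlim : Tendsto (fun n : ℕ => (orthoPoly μ n).eval z / (orthoPoly μ (n + 1)).eval z) atTop
      (𝓝 u)) :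
    Tendsto (fun n => ∑' k, shiftCoeff μ n k * u ^ k) atTop (𝓝 (z * u)) :=
  tendsto_tsum_of_recurrence (e := fun n => (orthoPoly μ n).eval z)
    (norm_shiftCoeff_le hρ hρ0 hinf) (fun n k hk => if_neg (by omega)) hρ0
    (mul_eval_orthoPoly_eq_sum hρ hinf z) (eval_orthoPoly_zero_ne_zero hρ hinf z) hz hlim

/-- For any `r < 1`, all consecutive ratios are at most `r` once `|z|` is large, uniformly in `n`,
so the bound passes to the limit `f`. -/
theorem tendsto_ratio_limit_cobounded (hρ : ∀ᵐ z ∂μ, ‖z‖ ≤ ρ) (hρ0 : 0 < ρ)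
    (hinf : μ.support.Infinite) {R : ℝ} {f : ℂ → ℂ} (hf : HasRatioAsymptotics μ R f) :
    Tendsto f (cobounded ℂ) (𝓝 0) := by
  rw [Metric.tendsto_nhds]
  intro ε hε
  obtain ⟨r, hr0, hr⟩ := exists_between (lt_min hε one_pos)
  have hr1 : r < 1 := hr.trans_le (min_le_right _ _)
  filter_upwards [eventually_cobounded_lt_norm R,
    eventually_cobounded_lt_norm (ρ / r + ρ / (1 - r))] with z hzR hz
  rw [dist_zero_right]
  refine (le_of_tendsto (hf.tendsto z hzR).norm (Eventually.of_forall fun n => ?_)).trans_lt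
    (hr.trans_le (min_le_left _ _))
  have h := ne_zero_and_norm_le_of_recurrence (e := fun n => (orthoPoly μ n).eval z)
    (norm_shiftCoeff_le hρ hρ0 hinf) hρ0 (mul_eval_orthoPoly_eq_sum hρ hinf z)
    (eval_orthoPoly_zero_ne_zero hρ hinf z) hr0 hr1 hz.le (n + 1)
  rw [norm_div, div_le_iff₀ (norm_pos_iff.2 h.1)]
  simpa using h.2 1 (by omega)

/-- `z f(z)` is the limit of series in `f(z)` whose constant terms `κ_n/κ_{n+1}` eventually exceed
`c`. The other terms add up to at most `2ρ|f(z)|`, below `c/2` once `|f(z)| < c/(4ρ)`. -/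
theorem exists_le_norm_mul_ratio_limit (hρ : ∀ᵐ z ∂μ, ‖z‖ ≤ ρ) (hρ0 : 0 < ρ)
    (hinf : μ.support.Infinite) {R : ℝ} {f : ℂ → ℂ} (hf : HasRatioAsymptotics μ R f)
    (hκ : 0 < liminf (fun n : ℕ => orthoLeadingCoeff μ n / orthoLeadingCoeff μ (n + 1)) atTop) :
    ∃ c : ℝ, 0 < c ∧ ∀ᶠ z in cobounded ℂ, c ≤ ‖z * f z‖ := by
  obtain ⟨c, hc0, hc⟩ := exists_between hκ
  have hev := eventually_lt_of_lt_liminf hc (isBoundedUnder_of ⟨0, fun n =>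
    (div_pos (orthoLeadingCoeff_pos hρ hinf n) (orthoLeadingCoeff_pos hρ hinf (n + 1))).le⟩)
  refine ⟨c / 2, half_pos hc0, ?_⟩
  have hft := (tendsto_ratio_limit_cobounded hρ hρ0 hinf hf).norm
  rw [norm_zero] at hft
  filter_upwards [eventually_cobounded_lt_norm R, eventually_cobounded_lt_norm (4 * ρ),
    hft.eventually_lt_const one_half_pos,
    hft.eventually_lt_const (show 0 < c / (4 * ρ) by positivity)] with z hzR hz h1 h2
  refine ge_of_tendsto (tendsto_tsum_shiftCoeff hρ hρ0 hinf hz.le (hf.tendsto z hzR)).norm ?_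
  filter_upwards [hev] with n hn
  have h3 := norm_tsum_mul_pow_sub_le (c := shiftCoeff μ n) (B := ρ) (K := 1) (u := f z)
    (by simpa using norm_shiftCoeff_le hρ hρ0 hinf n) zero_le_one (by linarith)
  have h4 : c ≤ ‖shiftCoeff μ n 0‖ := by
    rw [shiftCoeff, if_pos (by omega), Nat.sub_zero, polyInner_orthoPoly_succ hρ hinf,
      Complex.norm_real]
    exact hn.le.trans (le_abs_self _)
  rw [lt_div_iff₀ (by positivity)] at h2
  have h5 := norm_sub_norm_le (shiftCoeff μ n 0) (∑' k, shiftCoeff μ n k * f z ^ k)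
  rw [norm_sub_rev] at h5
  linarith

theorem tendsto_shiftCoeff (hρ : ∀ᵐ z ∂μ, ‖z‖ ≤ ρ) (hρ0 : 0 < ρ)
    (hinf : μ.support.Infinite) {R : ℝ} {f g : ℂ → ℂ} {β : ℤ → ℂ}
    (hf : HasRatioAsymptotics μ R f) (hf0 : ∀ᶠ z in cobounded ℂ, f z ≠ 0)
    (hg : IsInverseNearInfinity f g) (hβ : HasLaurentExpansionAtInfinity g β) (k : ℕ) :
    Tendsto (fun n => shiftCoeff μ n k) atTop (𝓝 (β ((k : ℤ) - 1))) := by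
  obtain ⟨ρ₁, -, hg⟩ := hg
  obtain ⟨ρ₂, -, hβ⟩ := hβ
  have hft : Tendsto f (cobounded ℂ) (𝓝[≠] 0) :=
    tendsto_nhdsWithin_iff.2 ⟨tendsto_ratio_limit_cobounded hρ hρ0 hinf hf, hf0⟩
  have hsum : ∀ᶠ z in cobounded ℂ,
      HasSum (fun k : ℕ => β ((k : ℤ) - 1) * f z ^ k) (z * f z) := by
    filter_upwards [eventually_cobounded_lt_norm ρ₁, hf0,
      (tendsto_inv₀_nhdsNE_zero.comp hft).eventually (eventually_cobounded_lt_norm ρ₂)]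
      with z hz hz0 hz2
    rw [Function.comp_apply, ← one_div] at hz2
    exact hasSum_laurent_of_inverse hz0 (hβ _ hz2) (hg z hz).2
  obtain ⟨z₀, hz₀, hz₀0⟩ := (hsum.and hf0).exists
  obtain ⟨B, K, hB, hK, hBK⟩ := exists_norm_le_mul_pow_of_summable hz₀0 hz₀.summable
  have hdiff : Tendsto (fun n => shiftCoeff μ n k - β ((k : ℤ) - 1)) atTop (𝓝 0) := by
    refine tendsto_coeff_zero_of_tendsto_tsum (c := fun n k => shiftCoeff μ n k - β ((k : ℤ) - 1))
      (B := ρ + B) (zero_lt_one.trans_le hK) k (fun n k => ?_) ?_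
    · refine (norm_sub_le _ _).trans ?_
      rw [add_mul]
      refine add_le_add ((norm_shiftCoeff_le hρ hρ0 hinf n k).trans ?_) (hBK k)
      exact le_mul_of_one_le_right hρ0.le (one_le_pow₀ hK)
    -- The test points are `u = f z`: they accumulate at zero because `f` tends to zero without
    -- vanishing near infinity.
    · refine hft.frequently (Eventually.frequently ?_)
      filter_upwards [hsum, eventually_cobounded_lt_norm R, eventually_cobounded_lt_norm (4 * ρ),
        hft.eventually (nhdsWithin_le_nhds (Metric.ball_mem_nhds 0 one_pos))] with z hz hzR hz4 hz1
      have h := (tendsto_tsum_shiftCoeff hρ hρ0 hinf hz4.le (hf.tendsto z hzR)).sub_const (z * f z)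
      rw [sub_self] at h
      refine h.congr fun n => ?_
      have hs : Summable fun k => shiftCoeff μ n k * f z ^ k :=
        summable_mul_pow_of_norm_le (B := ρ) (K := 1)
          (by simpa using norm_shiftCoeff_le hρ hρ0 hinf n) zero_le_one (by simpa using hz1)
      simp_rw [sub_mul]
      rw [hs.tsum_sub hz.summable, hz.tsum_eq]
  simpa using hdiff.add_const (β ((k : ℤ) - 1))

end Asymptotics

theorem theorem1p6 (μ : Measure ℂ) [IsFiniteMeasure μ]
    (hbdd : Bornology.IsBounded μ.support) (hinf : μ.support.Infinite)
    (R : ℝ) (hR : 0 < R) (f : ℂ → ℂ) (hf : HasRatioAsymptotics μ R f)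
    (hκ : 0 < liminf (fun n : ℕ => orthoLeadingCoeff μ n / orthoLeadingCoeff μ (n + 1)) atTop) :
    (∃ (g : ℂ → ℂ) (β : ℤ → ℂ),
      IsInverseNearInfinity f g ∧ HasLaurentExpansionAtInfinity g β) ∧
    ∀ (g : ℂ → ℂ) (β : ℤ → ℂ),
      IsInverseNearInfinity f g → HasLaurentExpansionAtInfinity g β →
      ∀ j : ℤ, -1 ≤ j →
        Tendsto (fun n : ℕ => bergmanShiftMatrix μ ((n : ℤ) - j).toNat n) atTop (𝓝 (β j)) := by
  obtain ⟨ρ, hρ0, hρ⟩ := hbdd.exists_pos_norm_le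
  replace hρ : ∀ᵐ z ∂μ, ‖z‖ ≤ ρ := by
    filter_upwards [Measure.support_mem_ae (μ := μ)] with z hz using hρ z hz
  obtain ⟨c, hc0, hc⟩ := exists_le_norm_mul_ratio_limit hρ hρ0 hinf hf hκ
  have hft := tendsto_ratio_limit_cobounded hρ hρ0 hinf hf
  refine ⟨?_, fun g β hg hβ j hj => ?_⟩
  · obtain ⟨F, hF, hfF⟩ := hf.analytic.analytic_at_infinity
    have hF0 : F 0 = 0 := by
      refine tendsto_nhds_unique (hF.continuousAt.tendsto.mono_left nhdsWithin_le_nhds)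
        ((hft.comp tendsto_inv₀_nhdsNE_zero).congr' ?_)
      filter_upwards [hfF] with w hw using hw.symm
    refine exists_inverse_near_infinity hF hF0
      (deriv_ne_zero_of_mul_norm_le hF.differentiableAt hF0 hc0 ?_) hfF
    filter_upwards [hfF, tendsto_inv₀_nhdsNE_zero.eventually hc, eventually_mem_nhdsWithin]
      with w hw hcw hw0
    rwa [norm_mul, norm_inv, ← hw, ← div_eq_inv_mul, le_div_iff₀ (norm_pos_iff.2 hw0)] at hcw
  · have hf0 : ∀ᶠ z in Bornology.cobounded ℂ, f z ≠ 0 := by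
      filter_upwards [hc] with z hz h
      rw [h, mul_zero, norm_zero] at hz
      exact hc0.not_ge hz
    obtain ⟨k, rfl⟩ : ∃ k : ℕ, j = (k : ℤ) - 1 := ⟨(j + 1).toNat, by omega⟩
    -- Passing from `n` to `n + 1` matches the column index with `φ_n`.
    rw [← tendsto_add_atTop_iff_nat 1]
    refine (tendsto_shiftCoeff hρ hρ0 hinf hf hf0 hg hβ k).congr' ?_
    filter_upwards [eventually_ge_atTop k] with n hn
    exact (bergmanShiftMatrix_eq_shiftCoeff μ (by omega)).symm
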